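/- For a finite group $G$ let $\pi(G)$ be the set of primes dividing $|G|$. The prime graph complement $\overline{\Gamma}(G)$ is the labelled graph with vertex set $\pi(G)$ in which two distinct primes $r,s$ are joined by an edge $r-s$ if and only if $G$ has no element of order $rs$. Let $T$ be a finite simple group and let $p\in\pi(T)$. Fix a maximal ideal $M$ containing $p$ of the ring $R$ of all algebraic integers in $\mathbb{C}$, and let $F=R/M$ (an algebraic closure of $\mathbb{F}_p$). The Brauer character of a representation $\rho:T\to\mathrm{GL}(n,F)$ is the function $\chi$ on the elements of $T$ of order prime to $p$ given by $\chi(g)=\xi_1+\dots+\xi_n$, where $\xi_1,\dots,\xi_n\in R$ are the roots of unity of order prime to $p$ whose reductions modulo $M$ are the eigenvalues of $\rho(g)$, counted with multiplicity. Let $\operatorname{IBr}_p(T)$ be the set of Brauer characters of the irreducible representations of $T$ over $F$. For $\chi\in\operatorname{IBr}_p(T)$ let $A_\chi$ be the set of all edges $p-q$, with $q\neq p$ a prime, such that there is a $g\in T$ of order $o(g)=q$ with $$\frac{1}{o(g)}\sum_{x\in\langle g\rangle}\chi(x)>0 .$$ Then, for every labelled graph $\Lambda$, the following are equivalent: (i)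 $\Lambda=\overline{\Gamma}(G)$ for some finite group $G$ of the form $N.T$ with $N$ a $p$-group, that is, some finite group $G$ with a normal $p$-subgroup $N$ such that $G/N\cong T$; (ii) there is a subset $Y\subseteq\operatorname{IBr}_p(T)$ such that $\Lambda=\overline{\Gamma}(T)\setminus\bigcup_{\chi\in Y}A_\chi$, that is, $\Lambda$ is obtained from $\overline{\Gamma}(T)$ by keeping all vertices and deleting every edge that lies in $\bigcup_{\chi\in Y}A_\chi$. -/

import Mathlib

noncomputable section

open scoped ComplexOrder

namespace PrimeGraphExtension

/-! ### Labelled graphs and prime graphs -/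

/-- A graph whose vertices are labelled by natural numbers: a set of vertices together with
an irreflexive symmetric adjacency relation on it. Equality is equality of labelled graphs. -/
abbrev LabeledGraph : Type := (⊤ : SimpleGraph ℕ).Subgraph

/-- The complement of a labelled graph: the same vertices, and two distinct vertices are adjacent
exactly when they were not. -/
def complement (Γ : LabeledGraph) : LabeledGraph where
  verts := Γ.verts
  Adj a b := a ∈ Γ.verts ∧ b ∈ Γ.verts ∧ a ≠ b ∧ ¬ Γ.Adj a b
  adj_sub h := h.2.2.1
  edge_vert h := h.1
  symm := ⟨fun _ _ h => ⟨h.2.1, h.1, h.2.2.1.symm, fun h' => h.2.2.2 h'.symm⟩⟩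

/-- The set of prime divisors of the order of a finite group. -/
def primeDivisors (G : Type*) : Set ℕ := {p | p.Prime ∧ p ∣ Nat.card G}

/-- The prime graph (Gruenberg--Kegel graph) of a finite group `G`: the vertices are the prime
divisors of `|G|`, and distinct `p`, `q` are adjacent if `G` has an element of order `p * q`. -/
def primeGraph (G : Type*) [Group G] : LabeledGraph where
  verts := primeDivisors G
  Adj a b := a ∈ primeDivisors G ∧ b ∈ primeDivisors G ∧ a ≠ b ∧ ∃ g : G, orderOf g = a * b
  adj_sub h := h.2.2.1
  edge_vert h := h.1
  symm := ⟨fun a b h => ⟨h.2.1, h.1, h.2.2.1.symm, by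
    obtain ⟨g, hg⟩ := h.2.2.2
    exact ⟨g, hg.trans (mul_comm a b)⟩⟩⟩

/-- The prime graph complement of a finite group. -/
def primeGraphComplement (G : Type*) [Group G] : LabeledGraph := complement (primeGraph G)

/-- `Λ` is the prime graph complement of some finite group `G` of the form `N.T` with `N` a
`p`-group. -/
def IsRealizableByPGroupExtension.{u} (p : ℕ) (T : Type u) [Group T] (Λ : LabeledGraph) : Prop :=
  ∃ (G : Type u) (_ : Group G) (_ : Finite G) (N : Subgroup G) (_ : N.Normal),
    IsPGroup p N ∧ Nonempty (G ⧸ N ≃* T) ∧ Λ = primeGraphComplement G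

/-! ### Brauer characters -/

/-- The ring of all algebraic integers in `ℂ`. -/
abbrev AlgebraicIntegers : Subalgebra ℤ ℂ := integralClosure ℤ ℂ

/-- The residue field of the ring of algebraic integers at a maximal ideal. If the ideal lies
above the prime `p`, this is an algebraic closure of the field with `p` elements. -/
def ResidueField (M : Ideal AlgebraicIntegers) : Type := AlgebraicIntegers ⧸ M

instance (M : Ideal AlgebraicIntegers) [M.IsMaximal] : Field (ResidueField M) :=
  Ideal.Quotient.field M

/-- The reduction of algebraic integers modulo the maximal ideal `M`. -/
def reduction (M : Ideal AlgebraicIntegers) [M.IsMaximal] : AlgebraicIntegers →+* ResidueField M :=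
  Ideal.Quotient.mk M

/-- The `p`-regular elements of `T`: those of order prime to `p`. -/
def PRegular (p : ℕ) (T : Type*) [Group T] : Type _ := {g : T // (orderOf g).Coprime p}

/-- Elements of the cyclic group generated by a `p`-regular element are `p`-regular. -/
def PRegular.ofMemZPowers {p : ℕ} {T : Type*} [Group T] (g : PRegular p T)
    (x : Subgroup.zpowers g.1) : PRegular p T :=
  ⟨x.1, Nat.Coprime.coprime_dvd_left (orderOf_dvd_of_mem_zpowers x.2) g.2⟩

/-- `χ` is the Brauer character mod `p` (with respect to `M`) of the representation `ρ` over the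
residue field of `M`: for every `p`-regular `g`, if the eigenvalues of `ρ g`, with multiplicity,
are the reductions of the complex roots of unity `ξ₁, …, ξₙ` of order prime to `p`,
then `χ g = ξ₁ + ⋯ + ξₙ`. -/
def IsBrauerCharacter (p : ℕ) (M : Ideal AlgebraicIntegers) [M.IsMaximal] {T : Type*} [Group T]
    {n : ℕ} (ρ : Representation (ResidueField M) T (Fin n → ResidueField M))
    (χ : PRegular p T → ℂ) : Prop :=
  ∀ g : PRegular p T, ∃ ξ : Multiset AlgebraicIntegers,
    (∀ z ∈ ξ, ∃ m : ℕ, m.Coprime p ∧ z ^ m = 1) ∧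
    (ρ g.1).charpoly = (ξ.map fun z => Polynomial.X - Polynomial.C (reduction M z)).prod ∧
    χ g = (ξ.map fun z => (z : ℂ)).sum

/-- The set of irreducible Brauer characters of `T` mod `p` (with respect to `M`). -/
def IBr (p : ℕ) (M : Ideal AlgebraicIntegers) [M.IsMaximal] (T : Type*) [Group T] :
    Set (PRegular p T → ℂ) :=
  {χ | ∃ (n : ℕ) (ρ : Representation (ResidueField M) T (Fin n → ResidueField M)),
    ρ.IsIrreducible ∧ IsBrauerCharacter p M ρ χ}

/-- The average of `χ` over the cyclic subgroup generated by the `p`-regular element `g`. -/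
def cyclicAverage {p : ℕ} {T : Type*} [Group T] (χ : PRegular p T → ℂ) (g : PRegular p T) : ℂ :=
  (1 / (orderOf g.1 : ℂ)) * ∑ᶠ x : Subgroup.zpowers g.1, χ (g.ofMemZPowers x)

/-- The set of edges `p - q`, with `q ≠ p` prime, for which some `g` of order `q` has a positive
average of `χ` over the cyclic subgroup it generates. Positivity of a complex number includes
that it is real. An element of prime order is `p`-regular exactly if its order is not `p`. -/
def fixedPointEdges (p : ℕ) {T : Type*} [Group T] (χ : PRegular p T → ℂ) : Set (Sym2 ℕ) :=
  {e | ∃ q : ℕ, q.Prime ∧ q ≠ p ∧ e = s(p, q) ∧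
    ∃ g : PRegular p T, orderOf g.1 = q ∧ 0 < cyclicAverage χ g}

end PrimeGraphExtension

end

open PrimeGraphExtension

open PrimeGraphExtension

noncomputable section

namespace PrimeGraphExtension

open scoped ComplexOrder

/-! ### Fixed vectors of linear endomorphisms and of representations -/

section FixedVectors

/-! Let G be an extension of T by a p-group N. Passing from T to G can only delete edges p - q of
the prime graph complement, and p - q is absent from that of G exactly when T has an element of
order pq or an element of order q has a lift to G centralizing a nontrivial element of N
(`FixesKernelElement`). The theorem thus compares fixed points in N with fixed vectors in
irreducible modules over F. The bridge is `cyclicAverage_pos_iff`: the average of a Brauer character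
over ⟨g⟩ is the multiplicity of the eigenvalue 1 of g, hence positive exactly when g fixes a nonzero
vector.

From G to Y: quotients by Ω₁(Z(N)), repeated if necessary, turn a fixed element of N into a fixed
vector in an F_p-module of T (`exists_zmod_representation`). After extending scalars to F, the
vector survives in some composition factor. Coprime action guarantees that no new fixed points of
elements of prime order q ≠ p appear on the way, so Y may consist of all irreducible characters
whose fixed points already occur in N.

From Y to G: the product of the modules in Y, viewed over F_p, contains a finite T-submodule in
which the same elements have fixed vectors; its split extension by T is G
(`exists_extension_of_representation`). -/

/-- The endomorphism `f` has a nonzero fixed vector. -/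
def HasFixedVector {k V : Type*} [Semiring k] [AddCommMonoid V] [Module k V] (f : V →ₗ[k] V) :
    Prop := ∃ v : V, v ≠ 0 ∧ f v = v

theorem HasFixedVector.of_semiconj {k V W : Type*} [Semiring k] [AddCommMonoid V] [Module k V]
    [AddCommMonoid W] [Module k W] {f : V →ₗ[k] V} {g : W →ₗ[k] W} (e : V →ₗ[k] W)
    (he : Function.Injective e) (h : ∀ v, e (f v) = g (e v)) (hf : HasFixedVector f) :
    HasFixedVector g := by
  obtain ⟨v, hv, hfv⟩ := hf
  exact ⟨e v, by rwa [Ne, map_eq_zero_iff e he], by rw [← h, hfv]⟩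

variable {k V : Type*} [Field k] [AddCommGroup V] [Module k V]

/-- Fixed vectors in a quotient lift, by averaging, for endomorphisms of order prime to the
characteristic. -/
theorem HasFixedVector.of_mapQ {f : V →ₗ[k] V} {W : Submodule k V} (hW : W ≤ W.comap f) {r : ℕ}
    (hr : (r : k) ≠ 0) (hf : f ^ r = 1) (h : HasFixedVector (W.mapQ W f hW)) :
    HasFixedVector f := by
  obtain ⟨w, hw, hfw⟩ := h
  obtain ⟨v, rfl⟩ := W.mkQ_surjective w
  have hpow : ∀ i : ℕ, W.mkQ ((f ^ i) v) = W.mkQ v := by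
    intro i
    induction i with
    | zero => simp
    | succ i ih =>
      rw [pow_succ', Module.End.mul_apply]
      calc W.mkQ (f ((f ^ i) v)) = W.mapQ W f hW (W.mkQ ((f ^ i) v)) := rfl
        _ = W.mkQ v := by rw [ih, hfw]
  -- The orbit sum maps to r times the class of v, which is nonzero; it is fixed because the
  -- difference telescopes to (f ^ r) v - v = 0.
  refine ⟨∑ i ∈ Finset.range r, (f ^ i) v, fun h0 => ?_, ?_⟩
  · have := congrArg W.mkQ h0
    rw [map_sum, map_zero, Finset.sum_congr rfl fun i _ => hpow i, Finset.sum_const,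
      Finset.card_range, ← Nat.cast_smul_eq_nsmul k, smul_eq_zero] at this
    exact this.elim hr hw
  · rw [map_sum]
    have : ∀ i, f ((f ^ i) v) = (f ^ (i + 1)) v := fun i => by
      rw [pow_succ', Module.End.mul_apply]
    simp_rw [this]
    rw [← sub_eq_zero, ← Finset.sum_sub_distrib, Finset.sum_range_sub (fun i => (f ^ i) v), hf]
    simp

/-- Without fixed vectors, f - 1 is injective, and injectivity survives the flat base change. -/
theorem hasFixedVector_of_baseChange (K : Type*) [Field K] [Algebra k K] {f : V →ₗ[k] V}
    (h : HasFixedVector (f.baseChange K)) : HasFixedVector f := by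
  by_contra hf
  have hinj : Function.Injective (f - LinearMap.id : V →ₗ[k] V) := by
    rw [injective_iff_map_eq_zero]
    intro v hv
    by_contra h0
    exact hf ⟨v, h0, sub_eq_zero.mp hv⟩
  obtain ⟨w, hw, hfw⟩ := h
  refine hw (Module.Flat.lTensor_preserves_injective_linearMap (M := K) _ hinj ?_)
  rw [map_zero, LinearMap.lTensor_sub, LinearMap.lTensor_id]
  exact sub_eq_zero.mpr hfw

theorem HasFixedVector.baseChange (K : Type*) [Field K] [Algebra k K] {f : V →ₗ[k] V}
    (h : HasFixedVector f) : HasFixedVector (f.baseChange K) := by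
  obtain ⟨v, hv, hfv⟩ := h
  have hinj : Function.Injective (TensorProduct.mk k K V 1) :=
    Module.FaithfullyFlat.tensorProduct_mk_injective V
  exact ⟨TensorProduct.mk k K V 1 v, by rwa [Ne, map_eq_zero_iff _ hinj], by simp [hfv]⟩

/-- Every finite-dimensional representation is isomorphic to one on a coordinate space. -/
theorem exists_coordinate_representation {T : Type*} [Group T] [FiniteDimensional k V]
    (τ : Representation k T V) :
    ∃ ρ : Representation k T (Fin (Module.finrank k V) → k),
      ∀ h, HasFixedVector (ρ h) ↔ HasFixedVector (τ h) := by
  let e : V ≃ₗ[k] (Fin (Module.finrank k V) → k) := (Module.finBasis k V).equivFun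
  refine ⟨(e.conjRingEquiv : Module.End k V →* _).comp τ, fun h => ⟨?_, ?_⟩⟩
  · exact .of_semiconj e.symm.toLinearMap e.symm.injective fun v => by simp
  · exact .of_semiconj e.toLinearMap e.injective fun v => by simp

/-- A fixed vector of `g` in a representation survives in some composition factor, and fixed
vectors in this factor of elements of order prime to the characteristic lift. -/
theorem exists_irreducible_hasFixedVector {T : Type*} [Group T] [FiniteDimensional k V]
    (τ : Representation k T V) {g : T} (hg : HasFixedVector (τ g)) :
    ∃ (n : ℕ) (ρ : Representation k T (Fin n → k)), ρ.IsIrreducible ∧ HasFixedVector (ρ g) ∧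
      ∀ h : T, (orderOf h : k) ≠ 0 → HasFixedVector (ρ h) → HasFixedVector (τ h) := by
  classical
  -- Among all modules with both required properties, one of least dimension is irreducible: a
  -- proper nonzero W could be replaced by W itself if it contains v, and by the quotient otherwise.
  let P : ℕ → Prop := fun n => ∃ ρ : Representation k T (Fin n → k), HasFixedVector (ρ g) ∧
    ∀ h : T, (orderOf h : k) ≠ 0 → HasFixedVector (ρ h) → HasFixedVector (τ h)
  have hP : ∃ n, P n := by
    obtain ⟨ρ, hρ⟩ := exists_coordinate_representation τ
    exact ⟨_, ρ, (hρ g).2 hg, fun h _ hh => (hρ h).1 hh⟩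
  obtain ⟨ρ, hρg, hρ⟩ := Nat.find_spec hP
  refine ⟨_, ρ, ?_, hρg, hρ⟩
  obtain ⟨v, hv, hgv⟩ := hρg
  have hne : Nontrivial (Subrepresentation ρ) := by
    refine ⟨⊥, ⊤, fun h => hv ?_⟩
    have : v ∈ (⊥ : Subrepresentation ρ) := by
      rw [h]; exact Submodule.mem_top
    exact (Submodule.mem_bot k).1 this
  refine { eq_bot_or_eq_top := fun W => ?_ }
  have hW : ∀ h, W.toSubmodule ≤ W.toSubmodule.comap (ρ h) := fun h => W.apply_mem_toSubmodule h
  by_cases hvW : v ∈ W.toSubmodule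
  · right
    by_contra htop
    have hlt : W.toSubmodule < ⊤ := lt_top_iff_ne_top.2 fun h =>
      htop (Subrepresentation.toSubmodule_injective h)
    have hdim := Submodule.finrank_lt hlt.ne
    rw [Module.finrank_fin_fun] at hdim
    obtain ⟨ρ', hρ'⟩ := exists_coordinate_representation (ρ.subrepresentation W.toSubmodule hW)
    refine Nat.find_min hP hdim ⟨ρ', (hρ' g).2 ⟨⟨v, hvW⟩, ?_, ?_⟩, fun h hh hf => ?_⟩
    · simpa using hv
    · exact Subtype.ext hgv
    · exact hρ h hh (((hρ' h).1 hf).of_semiconj W.toSubmodule.subtype Subtype.val_injective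
        fun v => rfl)
  · left
    by_contra hbot
    have hne : W.toSubmodule ≠ ⊥ := fun h => hbot (Subrepresentation.toSubmodule_injective h)
    have hdim : Module.finrank k ((Fin (Nat.find hP) → k) ⧸ W.toSubmodule) < Nat.find hP := by
      have h1 := W.toSubmodule.finrank_quotient_add_finrank
      have h2 := Submodule.one_le_finrank_iff.2 hne
      rw [Module.finrank_fin_fun] at h1
      omega
    obtain ⟨ρ', hρ'⟩ := exists_coordinate_representation (ρ.quotient W.toSubmodule hW)
    refine Nat.find_min hP hdim ⟨ρ', (hρ' g).2 ⟨W.toSubmodule.mkQ v, ?_, ?_⟩, fun h hh hf => ?_⟩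
    · simpa using hvW
    · exact congrArg W.toSubmodule.mkQ hgv
    · refine hρ h hh (HasFixedVector.of_mapQ (hW h) hh ?_ ((hρ' h).1 hf))
      rw [← map_pow, pow_orderOf_eq_one, map_one]

/-- The same over an extension field. -/
theorem exists_irreducible_hasFixedVector_extension (K : Type*) [Field K] [Algebra k K]
    {T : Type*} [Group T] [FiniteDimensional k V]
    (τ : Representation k T V) {g : T} (hg : HasFixedVector (τ g)) :
    ∃ (n : ℕ) (ρ : Representation K T (Fin n → K)), ρ.IsIrreducible ∧ HasFixedVector (ρ g) ∧
      ∀ h : T, (orderOf h : K) ≠ 0 → HasFixedVector (ρ h) → HasFixedVector (τ h) := by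
  let τK : Representation K T (TensorProduct k K V) :=
    (Module.End.baseChangeHom k K V : Module.End k V →* _).comp τ
  obtain ⟨n, ρ, hirr, hρg, hρ⟩ := exists_irreducible_hasFixedVector τK (hg.baseChange K)
  exact ⟨n, ρ, hirr, hρg, fun h hh hf => hasFixedVector_of_baseChange K (hρ h hh hf)⟩

end FixedVectors

/-! ### Roots of unity and Brauer characters -/

section BrauerCharacters

variable {p : ℕ} {M : Ideal AlgebraicIntegers} [M.IsMaximal]

theorem reduction_surjective : Function.Surjective (reduction M) := Ideal.Quotient.mk_surjective

/-- A monic polynomial over the residue field lifts to a monic one of the same degree over the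
algebraic integers; a complex root of the lift is again an algebraic integer, and reduces to a root.
-/
instance : IsAlgClosed (ResidueField M) := by
  refine IsAlgClosed.of_exists_root _ fun f hf hirr => ?_
  have hl : f ∈ Polynomial.lifts (reduction M) := by
    rw [Polynomial.lifts_iff_coeff_lifts]
    exact fun n => reduction_surjective _
  obtain ⟨q, hq, hdeg, hmonic⟩ := Polynomial.lifts_and_natDegree_eq_and_monic hl hf
  have hq0 : (q.map (algebraMap AlgebraicIntegers ℂ)).degree ≠ 0 := by
    rw [hmonic.degree_map, Polynomial.degree_eq_natDegree hmonic.ne_zero, hdeg]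
    exact_mod_cast hirr.natDegree_pos.ne'
  obtain ⟨x, hx⟩ := IsAlgClosed.exists_root _ hq0
  have hxR : IsIntegral AlgebraicIntegers x :=
    ⟨q, hmonic, by rwa [Polynomial.IsRoot.def, Polynomial.eval_map] at hx⟩
  have hxZ : IsIntegral ℤ x := isIntegral_trans (A := AlgebraicIntegers) x hxR
  refine ⟨reduction M ⟨x, hxZ⟩, ?_⟩
  rw [← hq, Polynomial.eval_map, Polynomial.eval₂_hom]
  have h0 : q.eval ⟨x, hxZ⟩ = 0 := by
    apply Subtype.val_injective
    rw [Polynomial.IsRoot.def, Polynomial.eval_map] at hx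
    have := Polynomial.hom_eval₂ q (RingHom.id _) (algebraMap AlgebraicIntegers ℂ) ⟨x, hxZ⟩
    rw [RingHom.comp_id] at this
    exact this.trans hx
  rw [h0, map_zero]

theorem charP_residueField (hp : p.Prime) (hM : (p : AlgebraicIntegers) ∈ M) :
    CharP (ResidueField M) p := by
  refine (CharP.charP_iff_prime_eq_zero hp).2 ?_
  rw [← map_natCast (reduction M)]
  exact Ideal.Quotient.eq_zero_iff_mem.2 hM

variable [CharP (ResidueField M) p]

theorem natCast_residueField_ne_zero (hp : p.Prime) {m : ℕ} (hm : m.Coprime p) :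
    (m : ResidueField M) ≠ 0 := by
  rw [Ne, CharP.cast_eq_zero_iff _ p]
  exact fun h => hp.one_lt.ne' (Nat.eq_one_of_dvd_coprimes hm h dvd_rfl)

/-- If z ≠ 1, then 1 + z + ⋯ + z^(m-1) = 0, but the reduction of this sum is m, which is nonzero
modulo p. -/
theorem eq_one_of_reduction_eq_one (hp : p.Prime) {m : ℕ} (hm : m.Coprime p)
    {z : AlgebraicIntegers} (hz : z ^ m = 1) (h : reduction M z = 1) : z = 1 := by
  by_contra h1
  have hs : ∑ i ∈ Finset.range m, z ^ i = 0 := by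
    have := mul_geom_sum z m
    rw [hz, sub_self] at this
    exact (mul_eq_zero.1 this).resolve_left (sub_ne_zero.2 h1)
  have := congrArg (reduction M) hs
  simp only [map_sum, map_pow, h, one_pow, Finset.sum_const, Finset.card_range, nsmul_eq_mul,
    mul_one, map_zero] at this
  exact natCast_residueField_ne_zero hp hm this

/-- Reduction is injective on the roots of unity of order prime to `p`. -/
theorem reduction_injOn (hp : p.Prime) : Set.InjOn (reduction M)
    {z | ∃ m : ℕ, m.Coprime p ∧ z ^ m = 1} := by
  rintro z ⟨m, hm, hz⟩ w ⟨l, hl, hw⟩ h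
  have hl0 : l ≠ 0 := by
    rintro rfl
    exact hp.one_lt.ne' (Nat.coprime_zero_left p |>.1 hl)
  have hw' : w * w ^ (l - 1) = 1 := by rw [mul_pow_sub_one hl0, hw]
  -- Since w^(l-1) is the inverse of w, the quotient z/w is a root of unity of order prime to p
  -- reducing to 1.
  have h1 : z * w ^ (l - 1) = 1 := by
    refine eq_one_of_reduction_eq_one (M := M) hp (hm.mul_left hl) ?_ ?_
    · rw [mul_pow, pow_mul, hz, one_pow, one_mul, ← pow_mul,
        show (l - 1) * (m * l) = l * ((l - 1) * m) by ring, pow_mul, hw, one_pow]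
    · rw [map_mul, h, ← map_mul, hw', map_one]
  calc z = z * w ^ (l - 1) * w := by rw [mul_assoc, mul_comm _ w, hw', mul_one]
    _ = w := by rw [h1, one_mul]

/-- A primitive complex m-th root of unity stays primitive under reduction, so the powers of its
reduction exhaust the m-th roots of unity in the residue field. -/
theorem exists_root_of_unity_lift (hp : p.Prime) {m : ℕ} (hm : m.Coprime p)
    {a : ResidueField M} (ha : a ^ m = 1) :
    ∃ z : AlgebraicIntegers, z ^ m = 1 ∧ reduction M z = a := by
  have hm0 : m ≠ 0 := by
    rintro rfl
    exact hp.one_lt.ne' (Nat.coprime_zero_left p |>.1 hm)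
  have hζ := Complex.isPrimitiveRoot_exp m hm0
  set ζ := Complex.exp (2 * Real.pi * Complex.I / m)
  let z : AlgebraicIntegers := ⟨ζ, hζ.isIntegral (Nat.pos_of_ne_zero hm0)⟩
  have hz : z ^ m = 1 := Subtype.val_injective hζ.pow_eq_one
  have hprim : IsPrimitiveRoot (reduction M z) m := by
    refine ⟨by rw [← map_pow, hz, map_one], fun l hl => hζ.dvd_of_pow_eq_one l ?_⟩
    rw [← map_pow] at hl
    exact congrArg Subtype.val (eq_one_of_reduction_eq_one (M := M) hp hm
      (by rw [← pow_mul, mul_comm, pow_mul, hz, one_pow] : (z ^ l) ^ m = 1) hl)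
  have : NeZero m := ⟨hm0⟩
  obtain ⟨i, -, hi⟩ := hprim.eq_pow_of_pow_eq_one ha
  exact ⟨z ^ i, by rw [← pow_mul, mul_comm, pow_mul, hz, one_pow], by rw [map_pow, hi]⟩

/-- An endomorphism of finite order prime to `p` is diagonalizable, with eigenvalues that are
reductions of roots of unity. -/
theorem exists_eigenvalue_lifts (hp : p.Prime) {m : ℕ} (hm : m.Coprime p) {n : ℕ}
    (f : Module.End (ResidueField M) (Fin n → ResidueField M)) (hf : f ^ m = 1) :
    ∃ ξ : Multiset AlgebraicIntegers, (∀ z ∈ ξ, z ^ m = 1) ∧ ∀ i : ℕ,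
      (f ^ i).charpoly =
        (ξ.map fun z => Polynomial.X - Polynomial.C (reduction M (z ^ i))).prod := by
  classical
  have hss : f.IsSemisimple := by
    refine Module.End.isSemisimple_of_squarefree_aeval_eq_zero (p := Polynomial.X ^ m -
      Polynomial.C 1) (Polynomial.separable_X_pow_sub_C 1
        (natCast_residueField_ne_zero hp hm) one_ne_zero).squarefree ?_
    simp [hf]
  let D := DirectSum.isInternal_submodule_of_iSupIndep_of_iSup_eq_top
    f.eigenspaces_iSupIndep hss.iSup_eigenspace_eq_top
  let I := (ν : ResidueField M) × Fin (Module.finrank (ResidueField M) (f.eigenspace ν))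
  let b : Module.Basis I (ResidueField M) (Fin n → ResidueField M) :=
    D.collectedBasis fun μ => Module.finBasis (ResidueField M) (f.eigenspace μ)
  have : Fintype I := FiniteDimensional.fintypeBasisIndex b
  have hb (j : I) : f (b j) = j.1 • b j :=
    Module.End.mem_eigenspace_iff.mp (D.collectedBasis_mem _ j)
  -- The eigenbasis diagonalizes all powers of f at once, so one multiset ξ serves for every i.
  have hbpow (i : ℕ) (j : I) : (f ^ i) (b j) = j.1 ^ i • b j := by
    induction i with
    | zero => simp
    | succ i ih => rw [pow_succ', Module.End.mul_apply, ih, map_smul, hb, smul_smul, pow_succ]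
  have hroot (j : I) : j.1 ^ m = 1 := by
    have h := hbpow m j
    rw [hf, Module.End.one_apply] at h
    exact (smul_left_injective (ResidueField M) (b.ne_zero j)
      (h.symm.trans (one_smul _ _).symm))
  choose z hz hzr using fun j => exists_root_of_unity_lift hp hm (hroot j)
  refine ⟨Finset.univ.val.map z, by simpa using hz, fun i => ?_⟩
  have hmat : LinearMap.toMatrix b b (f ^ i) = Matrix.diagonal fun j => j.1 ^ i := by
    ext j l
    rw [LinearMap.toMatrix_apply, hbpow, map_smul, b.repr_self, Finsupp.smul_single,
      smul_eq_mul, mul_one, Matrix.diagonal_apply, Finsupp.single_apply]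
    by_cases h : j = l
    · subst h; simp
    · simp [h, Ne.symm h]
  rw [← LinearMap.charpoly_toMatrix _ b, hmat, Matrix.charpoly_diagonal, Multiset.map_map]
  simp only [Function.comp_def, map_pow, hzr]
  rfl

theorem exists_isBrauerCharacter (hp : p.Prime) {T : Type*} [Group T] {n : ℕ}
    (ρ : Representation (ResidueField M) T (Fin n → ResidueField M)) :
    ∃ χ, IsBrauerCharacter p M ρ χ := by
  have h (g : PRegular p T) := exists_eigenvalue_lifts hp g.2 (ρ g.1)
    (by rw [← map_pow, pow_orderOf_eq_one, map_one])
  choose ξ hξ hξ' using h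
  refine ⟨fun g => ((ξ g).map fun z => (z : ℂ)).sum, fun g =>
    ⟨ξ g, fun z hz => ⟨_, g.2, hξ g z hz⟩, ?_, rfl⟩⟩
  simpa using hξ' g 1

/-- The multiset of lifted eigenvalues is determined by the characteristic polynomial. -/
theorem eq_of_prod_X_sub_C_reduction_eq (hp : p.Prime) {ξ η : Multiset AlgebraicIntegers}
    (hξ : ∀ z ∈ ξ, ∃ m : ℕ, m.Coprime p ∧ z ^ m = 1)
    (hη : ∀ z ∈ η, ∃ m : ℕ, m.Coprime p ∧ z ^ m = 1)
    (h : (ξ.map fun z => Polynomial.X - Polynomial.C (reduction M z)).prod =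
      (η.map fun z => Polynomial.X - Polynomial.C (reduction M z)).prod) : ξ = η := by
  have hroots (ζ : Multiset AlgebraicIntegers) :
      (ζ.map fun z => Polynomial.X - Polynomial.C (reduction M z)).prod.roots =
        ζ.map (reduction M) := by
    rw [← Polynomial.roots_multiset_prod_X_sub_C (ζ.map (reduction M)), Multiset.map_map]
    rfl
  have hr := congrArg Polynomial.roots h
  rw [hroots, hroots] at hr
  have hinv := (reduction_injOn (M := M) hp).leftInvOn_invFunOn
  have hback {ζ : Multiset AlgebraicIntegers} (hζ : ∀ z ∈ ζ, ∃ m : ℕ, m.Coprime p ∧ z ^ m = 1) :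
      (ζ.map (reduction M)).map (Function.invFunOn (reduction M)
        {z | ∃ m : ℕ, m.Coprime p ∧ z ^ m = 1}) = ζ := by
    rw [Multiset.map_map]
    exact (Multiset.map_congr rfl fun z hz => hinv (hζ z hz)).trans (Multiset.map_id' ζ)
  rw [← hback hξ, hr, hback hη]

/-- The average of a Brauer character over a cyclic `p`-regular subgroup is positive exactly if
the subgroup has a nonzero fixed vector. -/
theorem cyclicAverage_pos_iff (hp : p.Prime) {T : Type*} [Group T] [Finite T] {n : ℕ}
    {ρ : Representation (ResidueField M) T (Fin n → ResidueField M)} {χ : PRegular p T → ℂ}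
    (hχ : IsBrauerCharacter p M ρ χ) (g : PRegular p T) :
    0 < cyclicAverage χ g ↔ HasFixedVector (ρ g.1) := by
  classical
  obtain ⟨ξ, hξ, hchar⟩ := exists_eigenvalue_lifts hp g.2 (ρ g.1)
    (by rw [← map_pow, pow_orderOf_eq_one, map_one])
  have hval (x : Subgroup.zpowers g.1) (i : ℕ) (hi : x.1 = g.1 ^ i) :
      χ (g.ofMemZPowers x) = (ξ.map fun z : AlgebraicIntegers => (z : ℂ) ^ i).sum := by
    obtain ⟨η, hη, hηc, hηs⟩ := hχ (g.ofMemZPowers x)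
    have hx : (g.ofMemZPowers x).1 = g.1 ^ i := hi
    have : η = ξ.map (· ^ i) := by
      refine eq_of_prod_X_sub_C_reduction_eq (M := M) hp hη ?_ ?_
      · intro w hw
        obtain ⟨z, hz, rfl⟩ := Multiset.mem_map.1 hw
        exact ⟨_, g.2, by rw [← pow_mul, mul_comm, pow_mul, hξ z hz, one_pow]⟩
      · rw [← hηc, hx, map_pow, hchar, Multiset.map_map]
        rfl
    rw [hηs, this]
    simp [Multiset.bind_def, Multiset.pure_def, Multiset.bind_singleton, Multiset.map_map]
  have hpos : 0 < orderOf g.1 := orderOf_pos g.1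
  have hsum : cyclicAverage χ g = (ξ.count 1 : ℂ) := by
    have h1 : ∑ᶠ x : Subgroup.zpowers g.1, χ (g.ofMemZPowers x) =
        ∑ i ∈ Finset.range (orderOf g.1), (ξ.map fun z : AlgebraicIntegers => (z : ℂ) ^ i).sum := by
      rw [← finsum_comp_equiv (finEquivZPowers (isOfFinOrder_of_finite g.1)),
        finsum_eq_sum_of_fintype, ← Fin.sum_univ_eq_sum_range
          (fun i => (ξ.map fun z : AlgebraicIntegers => (z : ℂ) ^ i).sum)]
      exact Finset.sum_congr rfl fun i _ => hval _ i rfl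
    -- Orthogonality: only the eigenvalue 1 contributes to the average.
    have h2 : ∀ z ∈ ξ, ∑ i ∈ Finset.range (orderOf g.1), (z : ℂ) ^ i =
        orderOf g.1 * if 1 = z then 1 else 0 := by
      intro z hz
      split_ifs with h
      · subst h; simp
      · have h3 := mul_geom_sum (z : ℂ) (orderOf g.1)
        have h4 : (z : ℂ) ^ orderOf g.1 = 1 := congrArg Subtype.val (hξ z hz)
        rw [h4, sub_self] at h3
        rw [mul_zero]
        refine (mul_eq_zero.1 h3).resolve_left (sub_ne_zero.2 fun h5 => h ?_)
        exact (Subtype.val_injective h5).symm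
    have h0 : (orderOf g.1 : ℂ) ≠ 0 := by exact_mod_cast hpos.ne'
    rw [cyclicAverage, h1, ← Multiset.sum_map_sum, Multiset.map_congr rfl h2,
      Multiset.sum_map_mul_left, ← mul_assoc, one_div, inv_mul_cancel₀ h0, one_mul]
    have hcount (ζ : Multiset AlgebraicIntegers) :
        (ζ.map fun z => if 1 = z then (1 : ℂ) else 0).sum = ζ.count 1 := by
      induction ζ using Multiset.induction_on with
      | empty => simp
      | cons a s ih =>
        rw [Multiset.map_cons, Multiset.sum_cons, ih, Multiset.count_cons]
        push_cast
        ring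
    exact hcount ξ
  rw [hsum]
  have hev : HasFixedVector (ρ g.1) ↔ (ρ g.1).charpoly.IsRoot 1 := by
    rw [← Module.End.hasEigenvalue_iff_isRoot_charpoly]
    constructor
    · rintro ⟨v, hv, hgv⟩
      exact Module.End.hasEigenvalue_of_hasEigenvector
        (Module.End.hasEigenvector_iff.2 ⟨Module.End.mem_eigenspace_iff.2 (by simpa using hgv), hv⟩)
    · intro h
      obtain ⟨v, hv⟩ := h.exists_hasEigenvector
      exact ⟨v, hv.2, by simpa using hv.apply_eq_smul⟩
  have h1 := hchar 1
  simp only [pow_one] at h1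
  rw [hev, h1, Nat.cast_pos, Multiset.count_pos, Polynomial.IsRoot.def,
    Polynomial.eval_multiset_prod, Multiset.prod_eq_zero_iff, Multiset.map_map, Multiset.mem_map]
  simp only [Function.comp_apply, Polynomial.eval_sub, Polynomial.eval_X, Polynomial.eval_C]
  constructor
  · exact fun h => ⟨1, h, by simp⟩
  · rintro ⟨z, hz, h0⟩
    have := eq_one_of_reduction_eq_one (M := M) hp g.2 (hξ z hz) (sub_eq_zero.1 h0).symm
    exact this ▸ hz

end BrauerCharacters

/-! ### Elements of order `p * q` in extensions by `p`-groups -/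

section Extensions

/-- The element `h` has a preimage under `f` that commutes with a nontrivial element of the
kernel. -/
def FixesKernelElement {G T : Type*} [Group G] [Group T] (f : G →* T) (h : T) : Prop :=
  ∃ x z : G, f x = h ∧ f z = 1 ∧ z ≠ 1 ∧ Commute x z

variable {G T : Type*} [Group G] [Group T] {p : ℕ}

theorem exists_orderOf_pow_eq_of_dvd [Finite G] {x : G} {n : ℕ} (h : n ∣ orderOf x) :
    ∃ k, orderOf (x ^ k) = n :=
  ⟨_, orderOf_pow_orderOf_div (orderOf_pos x).ne' h⟩

/-- Suitable powers of the lift and of the kernel element commute and have orders q and p, so their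
product has order pq. -/
theorem FixesKernelElement.exists_orderOf_eq [Finite G] (hp : p.Prime) {f : G →* T}
    (hker : IsPGroup p f.ker) {h : T} {q : ℕ} (hq : q.Prime) (hqp : q ≠ p) (hh : orderOf h = q)
    (hf : FixesKernelElement f h) : ∃ g : G, orderOf g = p * q := by
  obtain ⟨x, z, hx, hz, hz1, hxz⟩ := hf
  obtain ⟨k, hk⟩ := exists_orderOf_pow_eq_of_dvd (x := x) (n := q)
    (by rw [← hh, ← hx]; exact orderOf_map_dvd f x)
  obtain ⟨a, ha⟩ := hker ⟨z, hz⟩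
  have hza : z ^ p ^ a = 1 := congrArg Subtype.val ha
  obtain ⟨b, -, hb⟩ := (Nat.dvd_prime_pow hp).1 (orderOf_dvd_of_pow_eq_one hza)
  have hb0 : b ≠ 0 := by
    rintro rfl
    exact hz1 (orderOf_eq_one_iff.1 (by simpa using hb))
  obtain ⟨l, hl⟩ := exists_orderOf_pow_eq_of_dvd (x := z) (n := p) (by rw [hb]; exact dvd_pow_self p hb0)
  refine ⟨z ^ l * x ^ k, ?_⟩
  rw [(hxz.symm.pow_pow l k).orderOf_mul_eq_mul_orderOf_of_coprime, hl, hk]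
  rw [hl, hk]
  exact (Nat.coprime_primes hp hq).2 hqp.symm

/-- With o the order of f x, the power x^o lies in the kernel and commutes with x. If it is trivial,
the order is preserved; otherwise f x fixes it, and only a factor p can have been lost. -/
theorem orderOf_image_or_fixesKernelElement (hp : p.Prime) {f : G →* T}
    (hker : IsPGroup p f.ker) {a b : ℕ} (ha : a.Prime) (hb : b.Prime) (hab : a ≠ b) {x : G}
    (hx : orderOf x = a * b) : orderOf (f x) = a * b ∨
      (a = p ∧ orderOf (f x) = b ∧ FixesKernelElement f (f x)) ∨
      (b = p ∧ orderOf (f x) = a ∧ FixesKernelElement f (f x)) := by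
  set o := orderOf (f x) with ho
  have hdvd : o ∣ a * b := hx ▸ orderOf_map_dvd f x
  have hz : f (x ^ o) = 1 := by rw [map_pow, ho, pow_orderOf_eq_one]
  obtain ⟨k, hk⟩ := hker ⟨x ^ o, hz⟩
  have hzk : (x ^ o) ^ p ^ k = 1 := congrArg Subtype.val hk
  have hab2 : a * b ∣ o * p ^ k := by
    rw [← hx]; exact orderOf_dvd_of_pow_eq_one (by rw [pow_mul, hzk])
  have hfix (hne : x ^ o ≠ 1) : FixesKernelElement f (f x) :=
    ⟨x, x ^ o, rfl, hz, hne, (Commute.refl x).pow_right o⟩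
  by_cases h1 : x ^ o = 1
  · exact Or.inl (Nat.dvd_antisymm hdvd (hx ▸ orderOf_dvd_of_pow_eq_one h1))
  have hprime {c : ℕ} (hc : c.Prime) (hcab : c ∣ a * b) (hcp : c ≠ p) : c ∣ o :=
    (hc.dvd_mul.1 (hcab.trans hab2)).resolve_right fun h =>
      hcp ((Nat.prime_dvd_prime_iff_eq hc hp).1 (hc.dvd_of_dvd_pow h))
  have hnot : ¬ a * b ∣ o := fun h => h1 (orderOf_dvd_iff_pow_eq_one.1 (hx ▸ h))
  have hcop : a.Coprime b := (Nat.coprime_primes ha hb).2 hab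
  by_cases hap : a = p
  · refine Or.inr (Or.inl ⟨hap, ?_, hfix h1⟩)
    obtain ⟨c, hc⟩ := hprime hb (dvd_mul_left b a) (hap ▸ hab.symm)
    have hca : c ∣ a := by
      rw [hc, mul_comm a] at hdvd; exact Nat.dvd_of_mul_dvd_mul_left hb.pos hdvd
    rcases (Nat.dvd_prime ha).1 hca with rfl | rfl
    · rw [hc, mul_one]
    · exact absurd (by rw [hc, mul_comm]) hnot
  · have hao := hprime ha (dvd_mul_right a b) hap
    by_cases hbp : b = p
    · refine Or.inr (Or.inr ⟨hbp, ?_, hfix h1⟩)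
      obtain ⟨c, hc⟩ := hao
      have hcb : c ∣ b := by
        rw [hc] at hdvd; exact Nat.dvd_of_mul_dvd_mul_left ha.pos hdvd
      rcases (Nat.dvd_prime hb).1 hcb with rfl | rfl
      · rw [hc, mul_one]
      · exact absurd (by rw [hc]) hnot
    · exact absurd (hcop.mul_dvd_of_dvd_of_dvd hao (hprime hb (dvd_mul_left b a) hbp)) hnot

theorem primeDivisors_eq_of_surjective [Finite G] (hp : p ∈ primeDivisors T) {f : G →* T}
    (hf : Function.Surjective f) (hker : IsPGroup p f.ker) :
    primeDivisors G = primeDivisors T := by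
  have : Fact p.Prime := ⟨hp.1⟩
  obtain ⟨k, hk⟩ := IsPGroup.iff_card.1 hker
  have hcard : Nat.card G = Nat.card T * p ^ k := by
    rw [← hk, Subgroup.card_eq_card_quotient_mul_card_subgroup f.ker,
      Nat.card_congr (QuotientGroup.quotientKerEquivOfSurjective f hf).toEquiv]
  ext r
  refine and_congr_right fun hr => ⟨fun h => ?_, fun h => hcard ▸ h.mul_right _⟩
  rw [hcard, hr.dvd_mul] at h
  rcases h with h | h
  · exact h
  · rw [(Nat.prime_dvd_prime_iff_eq hr hp.1).1 (hr.dvd_of_dvd_pow h)]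
    exact hp.2

/-- Fixed points in a coset of a normal `p`-subgroup, for elements of prime order different
from `p`. -/
theorem exists_commute_of_commutator_mem [Finite G] {V : Subgroup G} [V.Normal] (hp : p.Prime)
    (hV : IsPGroup p V) {r : ℕ} (hr : r.Prime) (hrp : r ≠ p) {x z : G} (hx : x ^ r = 1)
    (h : x * z * x⁻¹ * z⁻¹ ∈ V) : ∃ v ∈ V, Commute x (v * z) := by
  have : Fact p.Prime := ⟨hp⟩
  have : Fact r.Prime := ⟨hr⟩
  -- C is the coset Vz. Conjugation by x preserves it by the commutator hypothesis, and an r-group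
  -- acting on a set of p-power size has a fixed point.
  let C : Set G := {y | y * z⁻¹ ∈ V}
  let e : C ≃ V :=
    { toFun := fun y => ⟨y.1 * z⁻¹, y.2⟩
      invFun := fun v => ⟨v.1 * z, by simp [C]⟩
      left_inv := fun y => by simp
      right_inv := fun v => by simp }
  have hconj : ∀ y ∈ C, x * y * x⁻¹ ∈ C := by
    intro y hy
    have : x * y * x⁻¹ * z⁻¹ = (x * (y * z⁻¹) * x⁻¹) * (x * z * x⁻¹ * z⁻¹) := by group
    change _ ∈ V
    rw [this]
    exact V.mul_mem (Subgroup.Normal.conj_mem inferInstance _ hy x) h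
  have hconj' : ∀ g ∈ Subgroup.zpowers x, ∀ y ∈ C, g * y * g⁻¹ ∈ C := by
    intro g hg y hy
    obtain ⟨n, rfl⟩ := (Submonoid.mem_powers_iff _ _).1 (mem_powers_iff_mem_zpowers.2 hg)
    induction n with
    | zero => simpa using hy
    | succ n ih =>
      have := hconj _ (ih (Subgroup.npow_mem_zpowers x n))
      rwa [show x ^ (n + 1) * y * (x ^ (n + 1))⁻¹ = x * (x ^ n * y * (x ^ n)⁻¹) * x⁻¹ by
        rw [pow_succ']; group]
  let _ : MulAction (Subgroup.zpowers x) C :=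
    { smul := fun g y => ⟨g.1 * y.1 * g.1⁻¹, hconj' g.1 g.2 y.1 y.2⟩
      one_smul := fun y => Subtype.ext (by change 1 * y.1 * 1⁻¹ = y.1; simp)
      mul_smul := fun g g' y => Subtype.ext (by
        change (g.1 * g'.1) * y.1 * (g.1 * g'.1)⁻¹ = g.1 * (g'.1 * y.1 * g'.1⁻¹) * g.1⁻¹
        group) }
  have hrgroup : IsPGroup r (Subgroup.zpowers x) := by
    rintro ⟨g, hg⟩
    obtain ⟨n, rfl⟩ := Subgroup.mem_zpowers_iff.1 hg
    exact ⟨1, Subtype.ext (by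
      change (x ^ n) ^ r ^ 1 = 1
      rw [pow_one, ← zpow_natCast, ← zpow_mul, mul_comm, zpow_mul, zpow_natCast, hx, one_zpow])⟩
  obtain ⟨k, hk⟩ := IsPGroup.iff_card.1 hV
  obtain ⟨y, hy⟩ := hrgroup.nonempty_fixed_point_of_prime_not_dvd_card C (by
    rw [Nat.card_congr e, hk]
    exact fun h => hrp ((Nat.prime_dvd_prime_iff_eq hr hp).1 (hr.dvd_of_dvd_pow h)))
  refine ⟨y.1 * z⁻¹, y.2, ?_⟩
  rw [inv_mul_cancel_right]
  have : x * y.1 * x⁻¹ = y.1 :=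
    congrArg Subtype.val (hy ⟨x, Subgroup.mem_zpowers x⟩)
  exact mul_inv_eq_iff_eq_mul.1 this

end Extensions

/-! ### Modules from normal `p`-subgroups -/

section ElementaryAbelianSections

variable {G T : Type*} [Group G] [Group T] {p : ℕ}

/-- The central elements of the kernel of `f` whose `p`-th power is trivial. -/
def kernelSocle (p : ℕ) (f : G →* T) : Subgroup G where
  carrier := {z | f z = 1 ∧ (∀ y, f y = 1 → Commute y z) ∧ z ^ p = 1}
  one_mem' := ⟨map_one f, fun y _ => Commute.one_right y, one_pow p⟩
  mul_mem' := by
    rintro a b ⟨ha, ha', ha''⟩ ⟨hb, hb', hb''⟩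
    exact ⟨by rw [map_mul, ha, hb, one_mul], fun y hy => (ha' y hy).mul_right (hb' y hy),
      by rw [(hb' a ha).mul_pow, ha'', hb'', one_mul]⟩
  inv_mem' := by
    rintro a ⟨ha, ha', ha''⟩
    exact ⟨by rw [map_inv, ha, inv_one], fun y hy => (ha' y hy).inv_right,
      by rw [inv_pow, ha'', inv_one]⟩

instance kernelSocle_normal (f : G →* T) : (kernelSocle p f).Normal where
  conj_mem := by
    rintro z ⟨hz, hz', hz''⟩ g
    refine ⟨by simp [hz], fun y hy => ?_, by rw [conj_pow, hz'', mul_one, mul_inv_cancel]⟩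
    have h := hz' (g⁻¹ * y * g) (by simp [hy])
    have h' : (g⁻¹ * y * g) * z = z * (g⁻¹ * y * g) := h
    change y * (g * z * g⁻¹) = g * z * g⁻¹ * y
    calc y * (g * z * g⁻¹) = g * ((g⁻¹ * y * g) * z) * g⁻¹ := by group
      _ = g * (z * (g⁻¹ * y * g)) * g⁻¹ := by rw [h']
      _ = g * z * g⁻¹ * y := by group

theorem exists_mem_kernelSocle_ne_one [Finite G] (hp : p.Prime) {f : G →* T}
    (hker : IsPGroup p f.ker) {z : G} (hz : f z = 1) (hz1 : z ≠ 1) :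
    ∃ w ∈ kernelSocle p f, w ≠ 1 := by
  have : Fact p.Prime := ⟨hp⟩
  have : Nontrivial f.ker := ⟨⟨z, hz⟩, 1, fun h => hz1 (congrArg Subtype.val h)⟩
  have hn := hker.center_nontrivial
  obtain ⟨k, hk, hcard⟩ := (hker.to_subgroup (Subgroup.center f.ker)).nontrivial_iff_card.1 hn
  obtain ⟨w, hw⟩ := exists_prime_orderOf_dvd_card' (G := Subgroup.center f.ker) p
    (hcard ▸ dvd_pow_self p hk.ne')
  refine ⟨w.1.1, ⟨w.1.2, fun y hy => ?_, ?_⟩, fun h => ?_⟩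
  · exact congrArg Subtype.val (Subgroup.mem_center_iff.1 w.2 ⟨y, hy⟩)
  · have h := pow_orderOf_eq_one w
    rw [hw] at h
    exact congrArg (fun a => a.1.1) h
  · have h1 : w = 1 := Subtype.ext (Subtype.ext h)
    rw [h1, orderOf_one] at hw
    exact hp.one_lt.ne hw

instance (f : G →* T) : CommGroup (kernelSocle p f) :=
  { (inferInstance : Group (kernelSocle p f)) with
    mul_comm := fun a b => Subtype.ext (b.2.2.1 a.1 a.2.1) }

instance (f : G →* T) : Module (ZMod p) (Additive (kernelSocle p f)) :=
  AddCommGroup.zmodModule fun z => congrArg Additive.ofMul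
    (Subtype.ext z.toMul.2.2.2 : z.toMul ^ p = 1)

/-- The kernel centralizes its socle, so conjugation by G descends to T. -/
theorem exists_representation_on_kernelSocle {f : G →* T} (hf : Function.Surjective f) :
    ∃ σ : Representation (ZMod p) T (Additive (kernelSocle p f)),
      ∀ x : G, HasFixedVector (σ (f x)) ↔ ∃ z ∈ kernelSocle p f, z ≠ 1 ∧ Commute x z := by
  let φ : T →* MulAut (kernelSocle p f) := f.liftOfSurjective hf
    ⟨MulAut.conjNormal, fun y hy => by
      refine MulEquiv.ext fun z => Subtype.ext ?_
      rw [MulAut.conjNormal_apply]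
      exact mul_inv_eq_iff_eq_mul.2 (z.2.2.1 y hy)⟩
  have hφ (x : G) : φ (f x) = MulAut.conjNormal x :=
    MonoidHom.liftOfRightInverse_comp_apply ..
  let σ : Representation (ZMod p) T (Additive (kernelSocle p f)) :=
    { toFun := fun t => AddMonoidHom.toZModLinearMap p (MonoidHom.toAdditive (φ t).toMonoidHom)
      map_one' := LinearMap.ext fun z => by
        change Additive.ofMul (φ 1 z.toMul) = z
        rw [map_one]
        rfl
      map_mul' := fun s t => LinearMap.ext fun z => by
        change Additive.ofMul (φ (s * t) z.toMul) = Additive.ofMul (φ s (φ t z.toMul))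
        rw [map_mul]
        rfl }
  have hσ (x : G) (z : Additive (kernelSocle p f)) :
      (σ (f x) z).toMul.1 = x * z.toMul.1 * x⁻¹ := by
    change ((φ (f x)) z.toMul).1 = _
    rw [hφ, MulAut.conjNormal_apply]
  refine ⟨σ, fun x => ⟨?_, ?_⟩⟩
  · rintro ⟨v, hv, hxv⟩
    refine ⟨v.toMul.1, v.toMul.2, fun h => hv ?_, ?_⟩
    · exact congrArg Additive.ofMul (Subtype.ext h : v.toMul = 1)
    · have := hσ x v
      rw [hxv] at this
      exact (mul_inv_eq_iff_eq_mul.1 this.symm)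
  · rintro ⟨z, hz, hz1, hxz⟩
    refine ⟨Additive.ofMul ⟨z, hz⟩, fun h => hz1 ?_, ?_⟩
    · exact congrArg (fun a => a.toMul.1) h
    · refine congrArg Additive.ofMul (Subtype.ext ?_ : (σ (f x) _).toMul = ⟨z, hz⟩)
      rw [hσ]
      exact mul_inv_eq_iff_eq_mul.2 hxz

theorem FixesKernelElement.of_quotient [Finite G] (hp : p.Prime) {f : G →* T}
    (hker : IsPGroup p f.ker) {V : Subgroup G} [V.Normal] (hV : V ≤ f.ker) {h : T}
    (hh : (orderOf h).Prime) (hhp : orderOf h ≠ p)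
    (hq : FixesKernelElement (QuotientGroup.lift V f hV) h) : FixesKernelElement f h := by
  obtain ⟨x', z', hx, hz, hz1, hxz⟩ := hq
  obtain ⟨x, rfl⟩ := QuotientGroup.mk_surjective x'
  obtain ⟨z, rfl⟩ := QuotientGroup.mk_surjective z'
  rw [QuotientGroup.lift_mk] at hx hz
  obtain ⟨k, hk⟩ := hker ⟨x ^ orderOf h, by rw [MonoidHom.mem_ker, map_pow, hx, pow_orderOf_eq_one]⟩
  have hk' : (x ^ orderOf h) ^ p ^ k = 1 := congrArg Subtype.val hk
  -- With s inverse to p^k modulo the order of h, the power x^(p^k s) still lifts h, and its order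
  -- is now prime to p, as coprime action requires.
  obtain ⟨s, -, hs⟩ := Nat.exists_mul_mod_eq_one_of_coprime
    (((Nat.coprime_primes hp hh).2 hhp.symm).pow_left k) hh.one_lt
  have hxm : f (x ^ (p ^ k * s)) = h := by
    rw [map_pow, hx, ← pow_mod_orderOf, hs, pow_one]
  have hxr : (x ^ (p ^ k * s)) ^ orderOf h = 1 := by
    rw [← pow_mul, show p ^ k * s * orderOf h = orderOf h * p ^ k * s by ring, pow_mul, pow_mul,
      hk', one_pow]
  have hc : (x ^ (p ^ k * s)) * z * (x ^ (p ^ k * s))⁻¹ * z⁻¹ ∈ V := by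
    rw [← QuotientGroup.eq_one_iff]
    have h1 : Commute ((x : G ⧸ V) ^ (p ^ k * s)) (z : G ⧸ V) := hxz.pow_left _
    change (x : G ⧸ V) ^ (p ^ k * s) * z * ((x : G ⧸ V) ^ (p ^ k * s))⁻¹ * (z : G ⧸ V)⁻¹ = 1
    rw [h1.eq, mul_inv_cancel_right, mul_inv_cancel]
  obtain ⟨v, hv, hcomm⟩ := exists_commute_of_commutator_mem hp
    (hker.to_le hV) hh hhp hxr hc
  refine ⟨_, v * z, hxm, by rw [map_mul, hz, mul_one]; exact hV hv, fun h1 => hz1 ?_, hcomm⟩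
  rw [QuotientGroup.eq_one_iff, ← inv_eq_of_mul_eq_one_right h1]
  exact V.inv_mem hv

/-- If `g` fixes a nontrivial element of the kernel of `f`, then it has a nonzero fixed vector in
some finite module of characteristic `p` in which only those elements of prime order different
from `p` have nonzero fixed vectors that fix an element of the kernel. -/
theorem exists_zmod_representation.{u} {T : Type*} [Group T] {p : ℕ} (hp : p.Prime) (g : T) :
    ∀ (n : ℕ) (G : Type u) [Group G] [Finite G] (f : G →* T), Nat.card G = n →
      Function.Surjective f → IsPGroup p f.ker → FixesKernelElement f g →
      ∃ (V : Type u) (_ : AddCommGroup V) (_ : Module (ZMod p) V) (_ : Finite V)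
        (σ : Representation (ZMod p) T V), HasFixedVector (σ g) ∧
        ∀ h : T, (orderOf h).Prime → orderOf h ≠ p → HasFixedVector (σ h) →
          FixesKernelElement f h := by
  intro n
  induction n using Nat.strong_induction_on with
  | _ n ih =>
    rintro G _ _ f rfl hf hker ⟨x, z, hx, hz, hz1, hxz⟩
    by_cases hzV : z ∈ kernelSocle p f
    · obtain ⟨σ, hσ⟩ := exists_representation_on_kernelSocle (p := p) hf
      refine ⟨_, _, _, inferInstanceAs (Finite (kernelSocle p f)), σ,
        hx ▸ (hσ x).2 ⟨z, hzV, hz1, hxz⟩, fun h _ _ hh => ?_⟩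
      obtain ⟨y, rfl⟩ := hf h
      obtain ⟨w, hw, hw1, hyw⟩ := (hσ y).1 hh
      exact ⟨y, w, rfl, hw.1, hw1, hyw⟩
    -- Otherwise z survives in the quotient by the socle, which is smaller since the socle is
    -- nontrivial.
    · have hle : kernelSocle p f ≤ f.ker := fun w hw => hw.1
      let f' := QuotientGroup.lift (kernelSocle p f) f hle
      have hlt : Nat.card (G ⧸ kernelSocle p f) < Nat.card G := by
        obtain ⟨w, hw, hw1⟩ := exists_mem_kernelSocle_ne_one hp hker hz hz1
        have hnt : 1 < Nat.card (kernelSocle p f) :=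
          (Subgroup.one_lt_card_iff_ne_bot _).2 fun h => hw1 (by rwa [h, Subgroup.mem_bot] at hw)
        rw [Subgroup.card_eq_card_quotient_mul_card_subgroup (kernelSocle p f)]
        exact lt_mul_of_one_lt_right Nat.card_pos hnt
      have hker' : IsPGroup p f'.ker := by
        rintro ⟨y', hy⟩
        obtain ⟨y, rfl⟩ := QuotientGroup.mk_surjective y'
        obtain ⟨k, hk⟩ := hker ⟨y, hy⟩
        exact ⟨k, Subtype.ext (congrArg (fun a : f.ker => (a.1 : G ⧸ kernelSocle p f)) hk)⟩
      obtain ⟨V, i1, i2, i3, σ, hσg, hσ⟩ := ih _ hlt (G ⧸ kernelSocle p f) f' rfl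
        (QuotientGroup.lift_surjective_of_surjective _ _ hf _) hker'
        ⟨x, z, hx, hz, by rwa [Ne, QuotientGroup.eq_one_iff],
          hxz.map (QuotientGroup.mk' (kernelSocle p f))⟩
      exact ⟨V, i1, i2, i3, σ, hσg, fun h hh hhp hfix =>
        (hσ h hh hhp hfix).of_quotient hp hker hle hh hhp⟩

end ElementaryAbelianSections

/-! ### Finite extensions with prescribed fixed points -/

/-- A representation of a finite group in characteristic `p` gives an extension of the group by
a finite `p`-group in which the same elements have fixed points. -/
theorem exists_extension_of_representation.{u} {T U : Type u} [Group T] [Finite T] {p : ℕ}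
    (hp : p.Prime) [AddCommGroup U] [Module (ZMod p) U] (τ : Representation (ZMod p) T U) :
    ∃ (G : Type u) (_ : Group G) (_ : Finite G) (f : G →* T), Function.Surjective f ∧
      IsPGroup p f.ker ∧ ∀ h, FixesKernelElement f h ↔ HasFixedVector (τ h) := by
  classical
  have : NeZero p := ⟨hp.ne_zero⟩
  -- U may be infinite. The T-orbits of one chosen fixed vector for each g having one span a finite
  -- submodule that keeps all the fixed points needed.
  let v : T → U := fun g => if hg : HasFixedVector (τ g) then hg.choose else 0
  let S : Set U := Set.range fun x : T × T => τ x.1 (v x.2)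
  let W : Submodule (ZMod p) U := Submodule.span (ZMod p) S
  have hW : ∀ t, W ≤ W.comap (τ t) := by
    refine fun t => Submodule.span_le.2 ?_
    rintro _ ⟨⟨s, g⟩, rfl⟩
    refine Submodule.subset_span ⟨(t * s, g), ?_⟩
    simp
  have hfin : Finite W := by
    have : Module.Finite (ZMod p) W := Module.Finite.span_of_finite _ (Set.finite_range _)
    exact Module.finite_of_finite (ZMod p)
  let τW := τ.subrepresentation W hW
  let φ : T →* MulAut (Multiplicative W) :=
    { toFun := fun t =>
        { toFun := fun w => Multiplicative.ofAdd (τW t w.toAdd)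
          invFun := fun w => Multiplicative.ofAdd (τW t⁻¹ w.toAdd)
          left_inv := fun w => congrArg Multiplicative.ofAdd (τW.inv_self_apply t w.toAdd)
          right_inv := fun w => congrArg Multiplicative.ofAdd (τW.self_inv_apply t w.toAdd)
          map_mul' := fun w w' => congrArg Multiplicative.ofAdd (map_add (τW t) w.toAdd w'.toAdd) }
      map_one' := MulEquiv.ext fun w =>
        congrArg Multiplicative.ofAdd (LinearMap.congr_fun (map_one τW) w.toAdd)
      map_mul' := fun s t => MulEquiv.ext fun w =>
        congrArg Multiplicative.ofAdd (LinearMap.congr_fun (map_mul τW s t) w.toAdd) }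
  have hφ (t : T) (w : W) : φ t (Multiplicative.ofAdd w) = Multiplicative.ofAdd (τW t w) := rfl
  refine ⟨Multiplicative W ⋊[φ] T, inferInstance, ?_, SemidirectProduct.rightHom,
    SemidirectProduct.rightHom_surjective, ?_, fun h => ⟨?_, fun hh => ?_⟩⟩
  · have : Finite (Multiplicative W) := hfin
    exact Finite.of_equiv _ SemidirectProduct.equivProd.symm
  · rintro ⟨x, hx⟩
    rw [← SemidirectProduct.range_inl_eq_ker_rightHom] at hx
    obtain ⟨w, rfl⟩ := hx
    refine ⟨1, Subtype.ext ?_⟩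
    change (SemidirectProduct.inl w) ^ p ^ 1 = 1
    rw [pow_one, ← map_pow]
    have : w ^ p = 1 := congrArg Multiplicative.ofAdd (ZModModule.char_nsmul_eq_zero p w.toAdd)
    rw [this, map_one]
  · rintro ⟨x, z, rfl, hz, hz1, hxz⟩
    have hzr : z.right = 1 := hz
    refine ⟨z.left.toAdd.1, fun h0 => hz1 ?_, ?_⟩
    · exact SemidirectProduct.ext (congrArg Multiplicative.ofAdd (Subtype.ext h0)) hzr
    -- As W is abelian, the left component of x cancels, and x acts on z through its image in T.
    · have h1 := congrArg SemidirectProduct.left hxz.eq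
      rw [SemidirectProduct.mul_left, SemidirectProduct.mul_left, hzr, map_one, MulAut.one_apply,
        mul_comm] at h1
      exact congrArg (fun w : Multiplicative W => w.toAdd.1) (mul_right_cancel h1)
  · have hv : v h = hh.choose := dif_pos hh
    obtain ⟨h0, hfix⟩ := hv ▸ hh.choose_spec
    have hvW : v h ∈ W := Submodule.subset_span ⟨(1, h), by simp⟩
    refine ⟨SemidirectProduct.inr h, SemidirectProduct.inl (Multiplicative.ofAdd ⟨v h, hvW⟩),
      SemidirectProduct.rightHom_inr h, SemidirectProduct.rightHom_inl _, fun h1 => h0 ?_, ?_⟩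
    · have h2 := SemidirectProduct.inl_injective (h1.trans (map_one _).symm)
      exact congrArg (fun w : Multiplicative W => w.toAdd.1) h2
    · have h2 := SemidirectProduct.inl_aut (φ := φ) h (Multiplicative.ofAdd ⟨v h, hvW⟩)
      rw [hφ, show τW h ⟨v h, hvW⟩ = ⟨v h, hvW⟩ from Subtype.ext hfix, map_inv] at h2
      exact mul_inv_eq_iff_eq_mul.1 h2.symm

/-! ### Prime graph complements of extensions -/

theorem mem_fixedPointEdges_iff {p : ℕ} {T : Type*} [Group T] {χ : PRegular p T → ℂ} {q : ℕ}
    (hq : q.Prime) (hqp : q ≠ p) : s(p, q) ∈ fixedPointEdges p χ ↔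
      ∃ g : PRegular p T, orderOf g.1 = q ∧ 0 < cyclicAverage χ g := by
  constructor
  · rintro ⟨r, -, -, hr, h⟩
    rwa [Sym2.congr_right.1 hr]
  · exact fun h => ⟨q, hq, hqp, rfl, h⟩

/-- The hypothesis on Y makes its deleted edges p - q exactly those for which an element of order q
fixes a kernel element; these account for all new elements of order ab in G. -/
theorem primeGraphComplement_eq_deleteEdges {T G : Type*} [Group T] [Group G] [Finite T] [Finite G]
    {p : ℕ} (hp : p ∈ primeDivisors T) {f : G →* T} (hf : Function.Surjective f)
    (hker : IsPGroup p f.ker) {Y : Set (PRegular p T → ℂ)}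
    (hY : ∀ g : PRegular p T, (orderOf g.1).Prime →
      (FixesKernelElement f g.1 ↔ ∃ χ ∈ Y, 0 < cyclicAverage χ g)) :
    primeGraphComplement G =
      (primeGraphComplement T).deleteEdges (⋃ χ ∈ Y, fixedPointEdges p χ) := by
  have hπ := primeDivisors_eq_of_surjective hp hf hker
  have hedge {q : ℕ} (hq : q.Prime) (hqp : q ≠ p) : s(p, q) ∈ ⋃ χ ∈ Y, fixedPointEdges p χ ↔
      ∃ h, orderOf h = q ∧ FixesKernelElement f h := by
    simp only [Set.mem_iUnion, mem_fixedPointEdges_iff hq hqp]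
    constructor
    · rintro ⟨χ, hχ, g, rfl, hg⟩
      exact ⟨g.1, rfl, (hY g hq).2 ⟨χ, hχ, hg⟩⟩
    · rintro ⟨h, rfl, hh⟩
      let g : PRegular p T := ⟨h, (Nat.coprime_primes hq hp.1).2 hqp⟩
      obtain ⟨χ, hχ, hg⟩ := (hY g hq).1 hh
      exact ⟨χ, hχ, g, rfl, hg⟩
  have key {a b : ℕ} (ha : a.Prime) (hb : b.Prime) (hab : a ≠ b) :
      (∃ g : G, orderOf g = a * b) ↔
        (∃ t : T, orderOf t = a * b) ∨ s(a, b) ∈ ⋃ χ ∈ Y, fixedPointEdges p χ := by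
    constructor
    · rintro ⟨x, hx⟩
      rcases orderOf_image_or_fixesKernelElement hp.1 hker ha hb hab hx with
        h | ⟨rfl, h, hfix⟩ | ⟨rfl, h, hfix⟩
      · exact Or.inl ⟨_, h⟩
      · exact Or.inr ((hedge hb hab.symm).2 ⟨_, h, hfix⟩)
      · rw [Sym2.eq_swap]
        exact Or.inr ((hedge ha hab).2 ⟨_, h, hfix⟩)
    · rintro (⟨t, ht⟩ | h)
      · obtain ⟨x, rfl⟩ := hf t
        obtain ⟨k, hk⟩ := exists_orderOf_pow_eq_of_dvd (ht ▸ orderOf_map_dvd f x)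
        exact ⟨_, hk⟩
      · have h' := h
        simp only [Set.mem_iUnion] at h'
        obtain ⟨χ, -, q, hq, hqp, heq, -⟩ := h'
        rw [heq] at h
        obtain ⟨t, ht, hfix⟩ := (hedge hq hqp).1 h
        obtain ⟨g, hg⟩ := hfix.exists_orderOf_eq hp.1 hker hq hqp ht
        rcases Sym2.eq_iff.1 heq with ⟨rfl, rfl⟩ | ⟨rfl, rfl⟩
        · exact ⟨g, hg⟩
        · exact ⟨g, hg.trans (mul_comm _ _)⟩
  refine SimpleGraph.Subgraph.ext hπ ?_
  ext a b
  rw [SimpleGraph.Subgraph.deleteEdges_adj]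
  simp only [primeGraphComplement, complement, primeGraph, hπ]
  constructor
  · rintro ⟨ha, hb, hab, h⟩
    have := key ha.1 hb.1 hab
    tauto
  · rintro ⟨⟨ha, hb, hab, h⟩, h'⟩
    have := key ha.1 hb.1 hab
    tauto

theorem isRealizableByPGroupExtension_iff.{u} {T : Type u} [Group T] {p : ℕ} {Λ : LabeledGraph} :
    IsRealizableByPGroupExtension p T Λ ↔
      ∃ (G : Type u) (_ : Group G) (_ : Finite G) (f : G →* T), Function.Surjective f ∧
        IsPGroup p f.ker ∧ Λ = primeGraphComplement G := by
  constructor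
  · rintro ⟨G, _, _, N, _, hN, ⟨e⟩, rfl⟩
    refine ⟨G, _, ‹_›, e.toMonoidHom.comp (QuotientGroup.mk' N),
      e.surjective.comp (QuotientGroup.mk'_surjective N), ?_, rfl⟩
    have hker : (e.toMonoidHom.comp (QuotientGroup.mk' N)).ker = N := by
      ext x
      simp
    rwa [hker]
  · rintro ⟨G, _, _, f, hf, hker, rfl⟩
    exact ⟨G, _, ‹_›, f.ker, inferInstance, hker,
      ⟨QuotientGroup.quotientKerEquivOfSurjective f hf⟩, rfl⟩

/-- The realization theorem holds for arbitrary finite groups. -/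
theorem isRealizableByPGroupExtension_iff_exists_subset_iBr {T : Type*} [Group T] [Finite T] {p : ℕ}
    (hp : p ∈ primeDivisors T) (M : Ideal AlgebraicIntegers) [M.IsMaximal]
    (hM : (p : AlgebraicIntegers) ∈ M) (Λ : LabeledGraph) :
    IsRealizableByPGroupExtension p T Λ ↔
      ∃ Y : Set (PRegular p T → ℂ), Y ⊆ IBr p M T ∧
        Λ = (primeGraphComplement T).deleteEdges (⋃ χ ∈ Y, fixedPointEdges p χ) := by
  have : Fact p.Prime := ⟨hp.1⟩
  have : CharP (ResidueField M) p := charP_residueField hp.1 hM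
  let _ : Algebra (ZMod p) (ResidueField M) := ZMod.algebra _ p
  rw [isRealizableByPGroupExtension_iff]
  constructor
  · rintro ⟨G, _, _, f, hf, hker, rfl⟩
    -- The largest candidate for Y: every irreducible character whose fixed points are already
    -- present in the kernel.
    refine ⟨{χ ∈ IBr p M T | ∀ g : PRegular p T, (orderOf g.1).Prime →
      0 < cyclicAverage χ g → FixesKernelElement f g.1}, Set.sep_subset _ _,
      primeGraphComplement_eq_deleteEdges hp hf hker fun g hg => ⟨fun hfix => ?_, ?_⟩⟩
    · obtain ⟨V, _, _, _, σ, hσg, hσ⟩ :=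
        exists_zmod_representation hp.1 g.1 _ G f rfl hf hker hfix
      obtain ⟨n, ρ, hirr, hρg, hρ⟩ :=
        exists_irreducible_hasFixedVector_extension (ResidueField M) σ hσg
      obtain ⟨χ, hχ⟩ := exists_isBrauerCharacter hp.1 ρ
      refine ⟨χ, ⟨⟨n, ρ, hirr, hχ⟩, fun h hh hpos => ?_⟩, (cyclicAverage_pos_iff hp.1 hχ g).2 hρg⟩
      refine hσ h.1 hh ((Nat.coprime_primes hh hp.1).1 h.2) (hρ h.1 ?_ ?_)
      · exact natCast_residueField_ne_zero hp.1 h.2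
      · exact (cyclicAverage_pos_iff hp.1 hχ h).1 hpos
    · rintro ⟨χ, hχ, hpos⟩
      exact hχ.2 g hg hpos
  · rintro ⟨Y, hY, rfl⟩
    choose n ρ _ hρ using fun χ : Y => hY χ.2
    -- In the product module, an element has a nonzero fixed vector exactly when it has one in some
    -- factor.
    let τ : Representation (ZMod p) T (∀ χ : Y, Fin (n χ) → ResidueField M) :=
      { toFun := fun t => LinearMap.pi fun χ =>
          ((ρ χ t).restrictScalars (ZMod p)).comp (LinearMap.proj χ)
        map_one' := by ext; simp
        map_mul' := fun s t => by ext; simp }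
    obtain ⟨G, i1, i2, f, hf, hker, hfix⟩ := exists_extension_of_representation hp.1 τ
    refine ⟨G, i1, i2, f, hf, hker, (primeGraphComplement_eq_deleteEdges hp hf hker
      fun g _ => ?_).symm⟩
    rw [hfix]
    constructor
    · rintro ⟨v, hv, hgv⟩
      obtain ⟨χ, hχ⟩ := Function.ne_iff.1 hv
      exact ⟨χ, χ.2, (cyclicAverage_pos_iff hp.1 (hρ χ) g).2 ⟨v χ, hχ, congrFun hgv χ⟩⟩
    · rintro ⟨χ, hχ, hpos⟩
      classical
      obtain ⟨w, hw, hgw⟩ := (cyclicAverage_pos_iff hp.1 (hρ ⟨χ, hχ⟩) g).1 hpos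
      refine ⟨Pi.single ⟨χ, hχ⟩ w, by simpa using hw, funext fun ψ => ?_⟩
      change ρ ψ g.1 (Pi.single (M := fun χ : Y => Fin (n χ) → ResidueField M) ⟨χ, hχ⟩ w ψ) = _
      by_cases h : ψ = ⟨χ, hχ⟩
      · subst h
        rw [Pi.single_eq_same, hgw]
      · rw [Pi.single_eq_of_ne h, map_zero]

end PrimeGraphExtension

end

open PrimeGraphExtension

theorem mainTheorem5 (T : Type*) [Group T] [Finite T] [IsSimpleGroup T]
    (p : ℕ) (hp : p ∈ primeDivisors T)
    (M : Ideal AlgebraicIntegers) [M.IsMaximal] (hM : (p : AlgebraicIntegers) ∈ M)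
    (Λ : LabeledGraph) :
    IsRealizableByPGroupExtension p T Λ ↔
      ∃ Y : Set (PRegular p T → ℂ), Y ⊆ IBr p M T ∧
        Λ = (primeGraphComplement T).deleteEdges (⋃ χ ∈ Y, fixedPointEdges p χ) := by
  exact isRealizableByPGroupExtension_iff_exists_subset_iBr hp M hM Λ
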